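/- Let $G$ be a finite group. For $H\le G$ put $\hat H=\frac1{|H|}\sum_{h\in H}h\in\mathbb{Q}[G]$. For $K\unlhd H\le G$ put $\varepsilon(H,K)=\hat H$ if $H=K$, and otherwise $\varepsilon(H,K)=\prod_L(\hat K-\hat L)$, where $L$ runs over the minimal elements of the set of normal subgroups of $H$ containing $K$ properly. Let $e(G,H,K)$ be the sum of all the distinct $G$-conjugates of $\varepsilon(H,K)$, and let $\dim(H,K)$ be the $\mathbb{Q}$-dimension of $\mathbb{Q}[G]\,e(G,H,K)$. Let $\mathcal N$ be the set of all normal subgroups of $G$. For each $N\in\mathcal N$ fix a normal subgroup $A_N$ of $G$ containing $N$ such that $A_N/N$ is an abelian normal subgroup of maximal order in $G/N$. Let $\mathcal D_N$ be the set of all subgroups $D$ with $N\le D\le A_N$ such that $\bigcap_{x\in G}xDx^{-1}=N$ and such that $A_N/D$ is cyclic and is a maximal abelian subgroup of $N_G(D)/D$. Fix a set $\mathcal T_N$ of representatives of $\mathcal D_N$ under conjugacy of subgroups in $G$, and put $\mathcal S_N=\{(A_N,D)\mid D\in\mathcal T_N\}$. **Lemma.** If $\mathcal M\subseteq\mathcal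 N$ is such that $$\sum_{N\in\mathcal M}\ \sum_{(A_N,D)\in\mathcal S_N}\dim(A_N,D)=|G|,$$ then $\mathcal S_N=\emptyset$ for all $N\in\mathcal N\setminus\mathcal M$. -/

import Mathlib

namespace ShodaPair

noncomputable section

variable {G : Type*} [Group G]

/-- `hat H = |H|⁻¹ ∑_{h ∈ H} h` in the rational group algebra of a finite group. -/
def hat (H : Subgroup G) : MonoidAlgebra ℚ G :=
  (Nat.card H : ℚ)⁻¹ • ∑ᶠ h : H, MonoidAlgebra.of ℚ G (h : G)

/-- The set of minimal normal subgroups of `H` containing `K` properly: the minimal elements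
among the normal subgroups `L` of `H` with `K < L`. -/
def minNormalOver (H K : Subgroup G) : Set (Subgroup G) :=
  {L | Minimal (fun L : Subgroup G => K < L ∧ L ≤ H ∧ (L.subgroupOf H).Normal) L}

theorem of_mul_hat_of_mem [Finite G] {L : Subgroup G} {g : G} (hg : g ∈ L) :
    MonoidAlgebra.of ℚ G g * hat L = hat L := by
  have := Fintype.ofFinite L
  unfold hat
  rw [finsum_eq_sum_of_fintype, mul_smul_comm, Finset.mul_sum]
  congr 1
  refine Fintype.sum_equiv (Equiv.mulLeft (⟨g, hg⟩ : L)) _ _ fun h => ?_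
  simp

theorem hat_mul_of_of_mem [Finite G] {L : Subgroup G} {g : G} (hg : g ∈ L) :
    hat L * MonoidAlgebra.of ℚ G g = hat L := by
  have := Fintype.ofFinite L
  unfold hat
  rw [finsum_eq_sum_of_fintype, smul_mul_assoc, Finset.sum_mul]
  congr 1
  refine Fintype.sum_equiv (Equiv.mulRight (⟨g, hg⟩ : L)) _ _ fun h => ?_
  simp

theorem commute_of_hat [Finite G] {L : Subgroup G} {g : G}
    (hg : g ∈ Subgroup.normalizer (L : Set G)) :
    Commute (MonoidAlgebra.of ℚ G g) (hat L) := by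
  have := Fintype.ofFinite L
  unfold hat Commute SemiconjBy
  rw [finsum_eq_sum_of_fintype, mul_smul_comm, smul_mul_assoc, Finset.mul_sum, Finset.sum_mul]
  congr 1
  rw [Subgroup.mem_normalizer_iff] at hg
  refine Fintype.sum_bijective
    (fun h : L => (⟨g * h * g⁻¹, (hg h).1 h.2⟩ : L)) ⟨fun a b hab => ?_, fun b => ?_⟩ _ _
    fun h => ?_
  · simpa using hab
  · exact ⟨⟨g⁻¹ * b * g, (hg _).2 (by simp [mul_assoc])⟩, by simp [mul_assoc]⟩
  · rw [← map_mul, ← map_mul]; simp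

theorem commute_hat_hat [Finite G] {L L' : Subgroup G}
    (h : L' ≤ Subgroup.normalizer (L : Set G)) : Commute (hat L) (hat L') := by
  have := Fintype.ofFinite L'
  conv => arg 2; unfold hat
  rw [finsum_eq_sum_of_fintype]
  exact (Commute.sum_right _ _ _ fun x _ => (commute_of_hat (h x.2)).symm).smul_right _

theorem commute_factor [Finite G] (H K : Subgroup G) {L L' : Subgroup G}
    (hL : L ∈ minNormalOver H K) (hL' : L' ∈ minNormalOver H K) :
    Commute (hat K - hat L) (hat K - hat L') := by
  obtain ⟨⟨h1, h2, h3⟩, -⟩ := hL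
  obtain ⟨⟨h1', h2', h3'⟩, -⟩ := hL'
  have key : ∀ {M : Subgroup G}, K < M → Commute (hat K) (hat M) := fun {M} hM =>
    (commute_hat_hat (hM.le.trans Subgroup.le_normalizer)).symm
  have hLL : Commute (hat L) (hat L') :=
    commute_hat_hat (h2'.trans ((Subgroup.normal_subgroupOf_iff_le_normalizer h2).1 h3))
  exact ((Commute.refl _).sub_right (key h1')).sub_left ((key h1).symm.sub_right hLL)

open Classical in
/-- `ε(H, K)`: it is `hat H` if `H = K`, and otherwise the product of the pairwise commuting
factors `hat K - hat L`, where `L` runs over the minimal normal subgroups of `H` containing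
`K` properly. -/
def eps [Finite G] (H K : Subgroup G) : MonoidAlgebra ℚ G :=
  if H = K then hat H
  else (Set.toFinite (minNormalOver H K)).toFinset.noncommProd (fun L => hat K - hat L)
    (fun _ hL _ hL' _ => commute_factor H K
      ((Set.Finite.mem_toFinset _).1 hL) ((Set.Finite.mem_toFinset _).1 hL'))

/-- `e(G, H, K)`: the sum of all the distinct `G`-conjugates of `ε(H, K)`. -/
def idem [Finite G] (H K : Subgroup G) : MonoidAlgebra ℚ G :=
  ∑ᶠ y ∈ Set.range (fun g : G =>
    MonoidAlgebra.of ℚ G g * eps H K * MonoidAlgebra.of ℚ G g⁻¹), y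

/-- `dim(H, K)`: the `ℚ`-dimension of `ℚ[G] e(G, H, K) = {x * e(G, H, K) | x ∈ ℚ[G]}`. -/
def dim [Finite G] (H K : Subgroup G) : ℕ :=
  Module.finrank ℚ (LinearMap.range (LinearMap.mulRight ℚ (idem H K)))

/-- `A` is an admissible choice of `A_N`: a normal subgroup of `G` containing `N` such that
`A / N` is an abelian normal subgroup of `G / N` of maximal order. -/
structure IsMaxAbelianNormalOver (N : Subgroup G) [N.Normal] (A : Subgroup G) : Prop where
  normal : A.Normal
  le : N ≤ A
  comm : IsMulCommutative (A.map (QuotientGroup.mk' N))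
  card_le : ∀ B : Subgroup (G ⧸ N), B.Normal → IsMulCommutative B →
    Nat.card B ≤ Nat.card (A.map (QuotientGroup.mk' N))

/-- For `D ⊴ A ≤ N_G(D)`, this is `A / D` as a subgroup of `N_G(D) / D`. -/
def quotInNormalizer (A D : Subgroup G) :
    Subgroup (Subgroup.normalizer (D : Set G) ⧸ D.subgroupOf (Subgroup.normalizer (D : Set G))) :=
  (A.subgroupOf (Subgroup.normalizer (D : Set G))).map
    (QuotientGroup.mk' (D.subgroupOf (Subgroup.normalizer (D : Set G))))

/-- The set `𝒟_N` attached to `N` and the choice `A = A_N`: all subgroups `D` with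
`N ≤ D ≤ A` and `core_G(D) = N`, such that `D` is normal in `A` and `A / D` is cyclic and is a
maximal abelian subgroup of `N_G(D) / D`. -/
def setD (N A : Subgroup G) : Set (Subgroup G) :=
  {D | N ≤ D ∧ D ≤ A ∧ D.normalCore = N ∧ A ≤ Subgroup.normalizer (D : Set G) ∧
    IsCyclic (quotInNormalizer A D) ∧
    Maximal (fun B : Subgroup (Subgroup.normalizer (D : Set G) ⧸
      D.subgroupOf (Subgroup.normalizer (D : Set G))) => IsMulCommutative B)
      (quotInNormalizer A D)}

/-- `T` is a set of representatives of the set `X` of subgroups under conjugacy in `G`. -/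
def IsConjReps (X : Set (Subgroup G)) (T : Finset (Subgroup G)) : Prop :=
  (∀ D ∈ T, D ∈ X) ∧
    ∀ D ∈ X, ∃! D' : Subgroup G, D' ∈ T ∧ ∃ g : G, D.map (MulAut.conj g).toMonoidHom = D'

/-- `𝒮_N = {(A_N, D) | D ∈ 𝒯_N}`. -/
def setS (A : Subgroup G) (T : Finset (Subgroup G)) : Finset (Subgroup G × Subgroup G) :=
  {A} ×ˢ T

end

end ShodaPair

namespace ShodaPair

noncomputable section

open MonoidAlgebra (of)

/-! The elements `idem (A N) D`, over all pairs (N, D), are nonzero pairwise orthogonal idempotents.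
The left ideals they generate are therefore independent, so their dimensions, all positive, sum to
at most |G|. If the pairs with N in M already reach |G|, no further pair can exist.

Orthogonality rests on `Isolates`: an element of A fixing a nonzero element of ε(A, D)ℚ[G] lies in
D. For one A, a product of idempotents isolating D and D' is fixed by D and by D', so it vanishes
unless D = D'. For different N, `leftFixer_eq_of_idem_mul_eq` recovers N as the kernel K of the
action of G on any nonzero ideal fℚ[G], with f central and ef = f: K ∩ A lies in D, hence in its
core N; then [K, A] ≤ K ∩ A ≤ N, so K centralizes A/D, and maximality of A/D gives K ≤ A, so K ≤ N.
A nonzero product of two such idempotents would thus have two different kernels. That ε(A, D) ≠ 0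
comes from a faithful character of the cyclic group A/D. -/

theorem finrank_monoidAlgebra (G : Type*) [Finite G] :
    Module.finrank ℚ (MonoidAlgebra ℚ G) = Nat.card G := by
  have := Fintype.ofFinite G
  rw [(MonoidAlgebra.coeffLinearEquiv (S := ℚ) (M := G) ℚ).finrank_eq,
    Module.finrank_finsupp_self, Nat.card_eq_fintype_card]

theorem finiteDimensional_monoidAlgebra (G : Type*) [Finite G] :
    FiniteDimensional ℚ (MonoidAlgebra ℚ G) :=
  Module.Finite.equiv (MonoidAlgebra.coeffLinearEquiv (S := ℚ) (M := G) ℚ).symm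

/-! ### Left fixers and subgroup averages. -/

variable {G : Type*} [Group G]

/-- The subgroup of all `g ∈ G` with `g * w = w`. -/
def leftFixer (w : MonoidAlgebra ℚ G) : Subgroup G where
  carrier := {g | of ℚ G g * w = w}
  one_mem' := by simp [← MonoidAlgebra.one_def]
  mul_mem' {a b} ha hb := by
    simp only [Set.mem_ofPred_eq] at *
    rw [map_mul, mul_assoc, hb, ha]
  inv_mem' {a} ha := by
    simp only [Set.mem_ofPred_eq] at *
    conv_lhs => rw [← ha]
    rw [← mul_assoc, ← map_mul, inv_mul_cancel, map_one, one_mul]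

theorem mem_leftFixer {w : MonoidAlgebra ℚ G} {g : G} :
    g ∈ leftFixer w ↔ of ℚ G g * w = w := Iff.rfl

theorem leftFixer_le_mul (w z : MonoidAlgebra ℚ G) : leftFixer w ≤ leftFixer (w * z) := by
  intro g hg
  rw [mem_leftFixer] at *
  rw [← mul_assoc, hg]

theorem hat_mul_eq_smul_sum [Finite G] (L : Subgroup G) [Fintype L] (w : MonoidAlgebra ℚ G) :
    hat L * w = (Nat.card L : ℚ)⁻¹ • ∑ h : L, of ℚ G (h : G) * w := by
  unfold hat
  rw [finsum_eq_sum_of_fintype, smul_mul_assoc, Finset.sum_mul]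

theorem hat_mul_of_le_leftFixer [Finite G] {L : Subgroup G} {w : MonoidAlgebra ℚ G}
    (h : L ≤ leftFixer w) : hat L * w = w := by
  have := Fintype.ofFinite L
  rw [hat_mul_eq_smul_sum, Finset.sum_congr rfl fun x _ => mem_leftFixer.1 (h x.2),
    Finset.sum_const, Finset.card_univ, ← Nat.card_eq_fintype_card, ← Nat.cast_smul_eq_nsmul ℚ,
    smul_smul, inv_mul_cancel₀ (Nat.cast_ne_zero.2 Nat.card_pos.ne'), one_smul]

theorem le_leftFixer_hat [Finite G] (L : Subgroup G) : L ≤ leftFixer (hat L) :=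
  fun _ hg => of_mul_hat_of_mem hg

theorem hat_mul_hat_of_le [Finite G] {K L : Subgroup G} (h : K ≤ L) :
    hat K * hat L = hat L :=
  hat_mul_of_le_leftFixer (h.trans (le_leftFixer_hat L))

theorem hat_mul_hat_of_ge [Finite G] {K L : Subgroup G} (h : K ≤ L) :
    hat L * hat K = hat L := by
  rw [(commute_hat_hat (h.trans Subgroup.le_normalizer)).eq, hat_mul_hat_of_le h]

theorem commute_hat_of_forall [Finite G] {L : Subgroup G} {z : MonoidAlgebra ℚ G}
    (h : ∀ g ∈ L, Commute (of ℚ G g) z) : Commute (hat L) z := by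
  have := Fintype.ofFinite L
  unfold hat
  rw [finsum_eq_sum_of_fintype]
  exact (Commute.sum_left Finset.univ (fun x : L => of ℚ G (x : G)) z
    fun x _ => h x x.2).smul_left _

/-! ### Conjugation of subgroups and of ε(H, K). -/

/-- Conjugation by `g` on the rational group algebra. -/
def conjRingHom (g : G) : MonoidAlgebra ℚ G →+* MonoidAlgebra ℚ G where
  toFun x := of ℚ G g * x * of ℚ G g⁻¹
  map_one' := by rw [mul_one, ← map_mul, mul_inv_cancel, map_one]
  map_mul' x y := by
    have : of ℚ G g⁻¹ * of ℚ G g = 1 := by rw [← map_mul, inv_mul_cancel, map_one]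
    calc _ = of ℚ G g * x * 1 * y * of ℚ G g⁻¹ := by simp only [mul_assoc, mul_one]
      _ = _ := by rw [← this]; simp only [mul_assoc]
  map_zero' := by simp
  map_add' x y := by rw [mul_add, add_mul]

theorem conjRingHom_apply (g : G) (x : MonoidAlgebra ℚ G) :
    conjRingHom g x = of ℚ G g * x * of ℚ G g⁻¹ := rfl

theorem conjRingHom_of (g h : G) : conjRingHom g (of ℚ G h) = of ℚ G (g * h * g⁻¹) := by
  rw [conjRingHom_apply, map_mul, map_mul]

theorem conjRingHom_conjRingHom (g h : G) (x : MonoidAlgebra ℚ G) :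
    conjRingHom g (conjRingHom h x) = conjRingHom (g * h) x := by
  rw [conjRingHom_apply, conjRingHom_apply, conjRingHom_apply, mul_inv_rev, map_mul, map_mul]
  simp only [mul_assoc]

theorem conjRingHom_one (x : MonoidAlgebra ℚ G) : conjRingHom 1 x = x := by
  rw [conjRingHom_apply, inv_one, map_one, one_mul, mul_one]

theorem conjRingHom_inv_conjRingHom (g : G) (x : MonoidAlgebra ℚ G) :
    conjRingHom g⁻¹ (conjRingHom g x) = x := by
  rw [conjRingHom_conjRingHom, inv_mul_cancel, conjRingHom_one]

theorem conjRingHom_conjRingHom_inv (g : G) (x : MonoidAlgebra ℚ G) :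
    conjRingHom g (conjRingHom g⁻¹ x) = x := by
  rw [conjRingHom_conjRingHom, mul_inv_cancel, conjRingHom_one]

theorem conjRingHom_eq_self_iff {g : G} {x : MonoidAlgebra ℚ G} :
    conjRingHom g x = x ↔ Commute (of ℚ G g) x := by
  have h1 : of ℚ G g⁻¹ * of ℚ G g = 1 := by rw [← map_mul, inv_mul_cancel, map_one]
  have h2 : of ℚ G g * of ℚ G g⁻¹ = 1 := by rw [← map_mul, mul_inv_cancel, map_one]
  rw [conjRingHom_apply]
  constructor
  · intro h
    calc of ℚ G g * x = of ℚ G g * x * of ℚ G g⁻¹ * of ℚ G g := by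
          rw [mul_assoc _ _ (of ℚ G g), h1, mul_one]
      _ = _ := by rw [h]
  · intro h
    rw [h.eq, mul_assoc, h2, mul_one]

/-- The conjugate `g H g⁻¹`. -/
abbrev conjSubgroup (g : G) (H : Subgroup G) : Subgroup G :=
  H.map (MulAut.conj g).toMonoidHom

theorem mem_conjSubgroup {g x : G} {H : Subgroup G} :
    x ∈ conjSubgroup g H ↔ g⁻¹ * x * g ∈ H := by
  constructor
  · rintro ⟨h, hh, rfl⟩
    simpa [mul_assoc] using hh
  · intro h
    exact ⟨_, h, by simp [mul_assoc]⟩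

theorem conjSubgroup_conjSubgroup (g h : G) (H : Subgroup G) :
    conjSubgroup g (conjSubgroup h H) = conjSubgroup (g * h) H := by
  ext x
  simp only [mem_conjSubgroup, mul_inv_rev, mul_assoc]

theorem conjSubgroup_one (H : Subgroup G) : conjSubgroup 1 H = H := by
  ext x
  simp

theorem conjSubgroup_inv_conjSubgroup (g : G) (H : Subgroup G) :
    conjSubgroup g⁻¹ (conjSubgroup g H) = H := by
  rw [conjSubgroup_conjSubgroup, inv_mul_cancel, conjSubgroup_one]

theorem conjSubgroup_le_conjSubgroup {g : G} {H K : Subgroup G} :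
    conjSubgroup g H ≤ conjSubgroup g K ↔ H ≤ K :=
  Subgroup.map_le_map_iff_of_injective (MulAut.conj g).injective

theorem conjSubgroup_injective (g : G) : Function.Injective (conjSubgroup g) :=
  Subgroup.map_injective (MulAut.conj g).injective

theorem conjSubgroup_eq_self_of_normal (g : G) (H : Subgroup G) [H.Normal] :
    conjSubgroup g H = H := by
  ext x
  rw [mem_conjSubgroup]
  exact ⟨fun h => by simpa [mul_assoc] using Subgroup.Normal.conj_mem ‹_› _ h g,
    fun h => by simpa using Subgroup.Normal.conj_mem ‹_› _ h g⁻¹⟩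

theorem conjRingHom_hat [Finite G] (g : G) (H : Subgroup G) :
    conjRingHom g (hat H) = hat (conjSubgroup g H) := by
  have := Fintype.ofFinite H
  have := Fintype.ofFinite (conjSubgroup g H)
  have hc : Nat.card (conjSubgroup g H) = Nat.card H :=
    Subgroup.card_map_of_injective (MulAut.conj g).injective
  unfold hat
  rw [conjRingHom_apply, mul_smul_comm, smul_mul_assoc, hc, ← conjRingHom_apply,
    finsum_eq_sum_of_fintype, finsum_eq_sum_of_fintype, map_sum]
  congr 1
  refine Fintype.sum_equiv
    (H.equivMapOfInjective _ (MulAut.conj g).injective).toEquiv _ _ fun h => ?_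
  rw [conjRingHom_of]
  rfl

theorem mem_normalizer_iff_conj {g : G} {H : Subgroup G} :
    g ∈ Subgroup.normalizer (H : Set G) ↔ conjSubgroup g⁻¹ H = H := by
  rw [Subgroup.mem_normalizer_iff, SetLike.ext_iff]
  simp only [mem_conjSubgroup, inv_inv]
  exact forall_congr' fun _ => Iff.comm

theorem conjSubgroup_mem_minNormalOver {H K L : Subgroup G} (g : G) (hL : L ∈ minNormalOver H K) :
    conjSubgroup g L ∈ minNormalOver (conjSubgroup g H) (conjSubgroup g K) := by
  -- Quantified over `g` because minimality is transported back along `g⁻¹`.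
  have key : ∀ (g : G) {H K L : Subgroup G}, K < L ∧ L ≤ H ∧ (L.subgroupOf H).Normal →
      conjSubgroup g K < conjSubgroup g L ∧ conjSubgroup g L ≤ conjSubgroup g H ∧
        ((conjSubgroup g L).subgroupOf (conjSubgroup g H)).Normal := by
    rintro g H K L ⟨h1, h2, h3⟩
    have h2' := conjSubgroup_le_conjSubgroup (g := g).2 h2
    refine ⟨?_, h2', ?_⟩
    · rw [lt_iff_le_not_ge, conjSubgroup_le_conjSubgroup, conjSubgroup_le_conjSubgroup]
      exact lt_iff_le_not_ge.1 h1
    · rw [Subgroup.normal_subgroupOf_iff_le_normalizer h2']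
      rw [Subgroup.normal_subgroupOf_iff_le_normalizer h2] at h3
      rintro _ ⟨a, ha, rfl⟩
      have ha' := mem_normalizer_iff_conj.1 (h3 ha)
      rw [mem_normalizer_iff_conj, conjSubgroup_conjSubgroup]
      conv_rhs => rw [← ha', conjSubgroup_conjSubgroup]
      congr 1
      simp [mul_assoc]
  refine ⟨key g hL.1, fun M hM hML => ?_⟩
  have hM' := key g⁻¹ hM
  rw [conjSubgroup_inv_conjSubgroup, conjSubgroup_inv_conjSubgroup] at hM'
  have h1 := hL.2 hM' (by
    rw [← conjSubgroup_inv_conjSubgroup g L]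
    exact conjSubgroup_le_conjSubgroup.2 hML)
  rw [← conjSubgroup_le_conjSubgroup (g := g), conjSubgroup_conjSubgroup, mul_inv_cancel,
    conjSubgroup_one] at h1
  exact h1

theorem multiset_noncommProd_congr {α : Type*} [Monoid α] {s t : Multiset α} (h : s = t) (hs)
    (ht) : s.noncommProd hs = t.noncommProd ht := by
  subst h; rfl

theorem pairwise_commute_factor [Finite G] (H K : Subgroup G) :
    ((Set.toFinite (minNormalOver H K)).toFinset : Set (Subgroup G)).Pairwise
      (Function.onFun Commute fun L => hat K - hat L) :=
  fun _ hL _ hL' _ => commute_factor H K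
    ((Set.Finite.mem_toFinset _).1 hL) ((Set.Finite.mem_toFinset _).1 hL')

theorem eps_self [Finite G] (H : Subgroup G) : eps H H = hat H :=
  if_pos rfl

theorem eps_of_ne [Finite G] {H K : Subgroup G} (h : H ≠ K) :
    eps H K = (Set.toFinite (minNormalOver H K)).toFinset.noncommProd
      (fun L => hat K - hat L) (pairwise_commute_factor H K) :=
  if_neg h

theorem conjRingHom_eps [Finite G] (g : G) (H K : Subgroup G) :
    conjRingHom g (eps H K) = eps (conjSubgroup g H) (conjSubgroup g K) := by
  classical
  by_cases h : H = K
  · rw [h, eps_self, eps_self, conjRingHom_hat]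
  · rw [eps_of_ne h, eps_of_ne fun h' => h (conjSubgroup_injective g h'), Finset.map_noncommProd]
    refine multiset_noncommProd_congr ?_ _ _
    have himg : (Set.toFinite (minNormalOver (conjSubgroup g H) (conjSubgroup g K))).toFinset =
        (Set.toFinite (minNormalOver H K)).toFinset.map
          ⟨conjSubgroup g, conjSubgroup_injective g⟩ := by
      ext L
      simp only [Set.Finite.mem_toFinset, Finset.mem_map, Function.Embedding.coeFn_mk]
      constructor
      · intro hL
        refine ⟨conjSubgroup g⁻¹ L, ?_, ?_⟩
        · have := conjSubgroup_mem_minNormalOver g⁻¹ hL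
          rwa [conjSubgroup_inv_conjSubgroup, conjSubgroup_inv_conjSubgroup] at this
        · rw [conjSubgroup_conjSubgroup, mul_inv_cancel, conjSubgroup_one]
      · rintro ⟨L, hL, rfl⟩
        exact conjSubgroup_mem_minNormalOver g hL
    rw [himg, Finset.map_val, Multiset.map_map]
    refine Multiset.map_congr rfl fun L _ => ?_
    simp only [Function.comp_apply, map_sub, conjRingHom_hat, Function.Embedding.coeFn_mk]

/-! ### Isolating idempotents and their orthogonality. -/

/-- `x` is an idempotent in the bicommutant of `A` on which `D` acts trivially, and such that the
elements of `A` outside `D` act without fixed points on `x ℚ[G]`. -/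
structure Isolates (A D : Subgroup G) (x : MonoidAlgebra ℚ G) : Prop where
  mul_self : x * x = x
  le_leftFixer : D ≤ leftFixer x
  commute_of : ∀ a ∈ A, Commute (of ℚ G a) x
  commute : ∀ z, (∀ a ∈ A, Commute (of ℚ G a) z) → Commute x z
  mem : ∀ a ∈ A, ∀ y, of ℚ G a * (x * y) = x * y → a ∈ D ∨ x * y = 0

theorem Isolates.conj {A D : Subgroup G} [A.Normal] {x : MonoidAlgebra ℚ G}
    (h : Isolates A D x) (g : G) : Isolates A (conjSubgroup g D) (conjRingHom g x) := by
  have hconj : ∀ a, of ℚ G a = conjRingHom g (of ℚ G (g⁻¹ * a * g)) := fun a => by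
    rw [conjRingHom_of]; congr 1; simp [mul_assoc]
  have hA : ∀ a ∈ A, g⁻¹ * a * g ∈ A := fun a ha => by
    simpa using Subgroup.Normal.conj_mem ‹_› a ha g⁻¹
  refine ⟨by rw [← map_mul, h.mul_self], fun d hd => ?_, fun a ha => ?_, fun z hz => ?_,
    fun a ha y hy => ?_⟩
  · rw [mem_leftFixer, hconj, ← map_mul, mem_leftFixer.1 (h.le_leftFixer (mem_conjSubgroup.1 hd))]
  · rw [hconj]
    exact (h.commute_of _ (hA a ha)).map (conjRingHom g)
  · rw [← conjRingHom_conjRingHom_inv g z]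
    refine (h.commute _ fun a ha => ?_).map (conjRingHom g)
    have := (hz (g * a * g⁻¹) (Subgroup.Normal.conj_mem ‹_› a ha g)).map (conjRingHom g⁻¹)
    rw [conjRingHom_of] at this
    simpa [mul_assoc] using this
  · rw [← conjRingHom_conjRingHom_inv g y, ← map_mul] at hy ⊢
    rw [hconj, ← map_mul] at hy
    have hy' := congrArg (conjRingHom g⁻¹) hy
    rw [conjRingHom_inv_conjRingHom, conjRingHom_inv_conjRingHom] at hy'
    rw [mem_conjSubgroup]
    exact (h.mem _ (hA a ha) _ hy').imp_right fun h0 => by rw [h0, map_zero]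

theorem Isolates.commute_isolates {A D D' : Subgroup G} {x x' : MonoidAlgebra ℚ G}
    (h : Isolates A D x) (h' : Isolates A D' x') : Commute x x' :=
  h.commute _ h'.commute_of

/-- An element of `D'` outside `D` fixes `x' * x = x * x'`, which the last clause of `Isolates`
allows only for zero. -/
theorem Isolates.mul_eq_zero_of_not_le {A D D' : Subgroup G} {x x' : MonoidAlgebra ℚ G}
    (h : Isolates A D x) (h' : Isolates A D' x') (hD' : D' ≤ A) (hD : ¬ D' ≤ D) :
    x * x' = 0 := by
  obtain ⟨d, hd', hd⟩ := SetLike.not_le_iff_exists.1 hD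
  refine (h.mem d (hD' hd') x' ?_).resolve_left hd
  rw [(h.commute_isolates h').eq, ← mul_assoc, mem_leftFixer.1 (h'.le_leftFixer hd')]

theorem Isolates.mul_eq_zero {A D D' : Subgroup G} {x x' : MonoidAlgebra ℚ G}
    (h : Isolates A D x) (h' : Isolates A D' x') (hD : D ≤ A) (hD' : D' ≤ A) (hne : D ≠ D') :
    x * x' = 0 := by
  by_cases hle : D' ≤ D
  · rw [(h.commute_isolates h').eq]
    exact h'.mul_eq_zero_of_not_le h hD fun hle' => hne (le_antisymm hle' hle)
  · exact h.mul_eq_zero_of_not_le h' hD' hle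

/-! ### ε(A, D) isolates D when A/D is abelian. -/

theorem hat_mul_factor [Finite G] {K L : Subgroup G} (h : K ≤ L) :
    hat L * (hat K - hat L) = 0 := by
  rw [mul_sub, hat_mul_hat_of_ge h, hat_mul_hat_of_le le_rfl, sub_self]

theorem factor_mul_factor [Finite G] {K L : Subgroup G} (h : K ≤ L) :
    (hat K - hat L) * (hat K - hat L) = hat K - hat L := by
  rw [sub_mul, hat_mul_factor h, sub_zero, mul_sub, hat_mul_hat_of_le le_rfl, hat_mul_hat_of_le h]

theorem exists_eps_eq_factor_mul [Finite G] {H K L : Subgroup G} (h : H ≠ K)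
    (hL : L ∈ minNormalOver H K) : ∃ y, eps H K = (hat K - hat L) * y := by
  classical
  rw [eps_of_ne h]
  exact ⟨_, (Finset.mul_noncommProd_erase _ ((Set.Finite.mem_toFinset _).2 hL) _ _).symm⟩

theorem eps_induction [Finite G] {H K : Subgroup G} (h : H ≠ K) (p : MonoidAlgebra ℚ G → Prop)
    (mul : ∀ a b, p a → p b → p (a * b)) (one : p 1)
    (factor : ∀ L ∈ minNormalOver H K, p (hat K - hat L)) : p (eps H K) := by
  rw [eps_of_ne h]
  exact Finset.noncommProd_induction _ _ _ p mul one
    fun L hL => factor L ((Set.Finite.mem_toFinset _).1 hL)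

theorem hat_mul_eps [Finite G] {H K L : Subgroup G} (h : H ≠ K) (hL : L ∈ minNormalOver H K) :
    hat L * eps H K = 0 := by
  obtain ⟨y, hy⟩ := exists_eps_eq_factor_mul h hL
  rw [hy, ← mul_assoc, hat_mul_factor hL.1.1.le, zero_mul]

theorem exists_mem_minNormalOver_le [Finite G] {H K L : Subgroup G} (h1 : K < L) (h2 : L ≤ H)
    (h3 : (L.subgroupOf H).Normal) : ∃ M ∈ minNormalOver H K, M ≤ L := by
  obtain ⟨M, hML, hM⟩ := exists_minimal_le_of_wellFoundedLT
    (fun L : Subgroup G => K < L ∧ L ≤ H ∧ (L.subgroupOf H).Normal) L ⟨h1, h2, h3⟩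
  exact ⟨M, hM, hML⟩

/-- A subgroup between `D` and `A` is normal in `A` if `A / D` is abelian. -/
theorem normal_subgroupOf_of_commutator_mem {A D L : Subgroup G}
    (hcomm : ∀ a ∈ A, ∀ b ∈ A, a * b * a⁻¹ * b⁻¹ ∈ D) (hDL : D ≤ L) (hLA : L ≤ A) :
    (L.subgroupOf A).Normal := by
  refine ⟨fun l hl a => ?_⟩
  rw [Subgroup.mem_subgroupOf] at *
  have := L.mul_mem (hDL (hcomm a a.2 l (hLA hl))) hl
  simpa using this

/-- If `a` outside `D` fixes `eps A D * y`, so does D⟨a⟩, hence some minimal `L` below it; but `hat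
L` annihilates `eps A D`. -/
theorem isolates_eps [Finite G] {A D : Subgroup G} (hDA : D ≤ A)
    (hcomm : ∀ a ∈ A, ∀ b ∈ A, a * b * a⁻¹ * b⁻¹ ∈ D) : Isolates A D (eps A D) := by
  by_cases h : A = D
  · subst h
    rw [eps_self]
    refine ⟨hat_mul_hat_of_le le_rfl, le_leftFixer_hat A, fun a ha => ?_,
      fun z hz => commute_hat_of_forall hz, fun a ha _ _ => Or.inl ha⟩
    exact commute_of_hat (Subgroup.le_normalizer ha)
  have hlt : D < A := lt_of_le_of_ne hDA (Ne.symm h)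
  have hnorm : ∀ {L : Subgroup G}, D ≤ L → L ≤ A → A ≤ Subgroup.normalizer (L : Set G) :=
    fun h1 h2 => (Subgroup.normal_subgroupOf_iff_le_normalizer h2).1
      (normal_subgroupOf_of_commutator_mem hcomm h1 h2)
  have hfix : D ≤ leftFixer (eps A D) := by
    obtain ⟨L, hL, -⟩ := exists_mem_minNormalOver_le hlt le_rfl
      (normal_subgroupOf_of_commutator_mem hcomm hDA le_rfl)
    obtain ⟨y, hy⟩ := exists_eps_eq_factor_mul h hL
    rw [hy]
    refine le_trans (fun d hd => ?_) (leftFixer_le_mul _ _)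
    rw [mem_leftFixer, mul_sub, of_mul_hat_of_mem hd, of_mul_hat_of_mem (hL.1.1.le hd)]
  refine ⟨?_, hfix, fun a ha => ?_, fun z hz => ?_, fun a ha y hy => ?_⟩
  -- Each factor is idempotent and can be pulled to the front of the product, so it fixes `eps A D`.
  · refine eps_induction h (fun y => y * eps A D = eps A D) (fun a b ha hb => ?_) (one_mul _)
      fun L hL => ?_
    · rw [mul_assoc, hb, ha]
    · obtain ⟨y, hy⟩ := exists_eps_eq_factor_mul h hL
      rw [hy, ← mul_assoc, factor_mul_factor hL.1.1.le]
  · refine eps_induction h (fun y => Commute (of ℚ G a) y) (fun _ _ => Commute.mul_right)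
      (Commute.one_right _) fun L hL => ?_
    exact (commute_of_hat (hnorm le_rfl hDA ha)).sub_right
      (commute_of_hat (hnorm hL.1.1.le hL.1.2.1 ha))
  · refine eps_induction h (fun y => Commute y z) (fun _ _ => Commute.mul_left)
      (Commute.one_left _) fun L hL => ?_
    exact (commute_hat_of_forall fun g hg => hz g (hDA hg)).sub_left
      (commute_hat_of_forall fun g hg => hz g (hL.1.2.1 hg))
  · by_contra! hcon
    have hlt' : D < D ⊔ Subgroup.zpowers a := by
      refine lt_of_le_of_ne le_sup_left fun heq => hcon.1 ?_
      rw [heq]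
      exact (le_sup_right : Subgroup.zpowers a ≤ _) (Subgroup.mem_zpowers a)
    have hle : D ⊔ Subgroup.zpowers a ≤ A := sup_le hDA (Subgroup.zpowers_le.2 ha)
    obtain ⟨L, hL, hLa⟩ := exists_mem_minNormalOver_le hlt' hle
      (normal_subgroupOf_of_commutator_mem hcomm le_sup_left hle)
    have hLw : L ≤ leftFixer (eps A D * y) := hLa.trans
      (sup_le (hfix.trans (leftFixer_le_mul _ _)) (Subgroup.zpowers_le.2 (mem_leftFixer.2 hy)))
    apply hcon.2
    rw [← hat_mul_of_le_leftFixer hLw, ← mul_assoc, hat_mul_eps h hL, zero_mul]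

/-- A linear functional extending χ is unchanged by multiplication by `eps A D` and takes the value
1 at 1. -/
theorem eps_ne_zero [Finite G] {A D : Subgroup G} (hDA : D ≤ A) (χ : A →* ℂ)
    (hχ : ∀ a : A, χ a = 1 ↔ (a : G) ∈ D) : eps A D ≠ 0 := by
  classical
  -- χ extended by zero off `A`; it stays multiplicative for left multiplication by `A`.
  let φ : MonoidAlgebra ℚ G →ₗ[ℚ] ℂ :=
    (Finsupp.linearCombination ℚ fun g => if h : g ∈ A then χ ⟨g, h⟩ else 0) ∘ₗ
      (MonoidAlgebra.coeffLinearEquiv ℚ).toLinearMap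
  have hφof : ∀ g, φ (of ℚ G g) = if h : g ∈ A then χ ⟨g, h⟩ else 0 := fun g => by
    simp [φ]
  have hφ1 : φ 1 = 1 := by
    rw [← map_one (of ℚ G), hφof, dif_pos A.one_mem]
    exact map_one χ
  have hφmul : ∀ (a : A) z, φ (of ℚ G (a : G) * z) = χ a * φ z := by
    intro a z
    induction z using MonoidAlgebra.induction_on with
    | of g =>
      rw [← map_mul, hφof, hφof]
      by_cases hg : g ∈ A
      · rw [dif_pos hg, dif_pos (A.mul_mem a.2 hg), ← map_mul]
        rfl
      · rw [dif_neg hg, dif_neg fun h => hg ((Subgroup.mul_mem_cancel_left A a.2).1 h), mul_zero]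
    | add f g hf hg => rw [mul_add, map_add, map_add, hf, hg, mul_add]
    | smul r f hf => rw [mul_smul_comm, map_smul, map_smul, hf, mul_smul_comm]
  have hD : ∀ z, φ (hat D * z) = φ z := by
    intro z
    have := Fintype.ofFinite D
    rw [hat_mul_eq_smul_sum, map_smul, map_sum, Finset.sum_congr rfl fun (d : D) _ =>
      (hφmul ⟨d, hDA d.2⟩ z).trans (by rw [(hχ _).2 d.2, one_mul]),
      Finset.sum_const, Finset.card_univ, ← Nat.card_eq_fintype_card, ← Nat.cast_smul_eq_nsmul ℚ,
      smul_smul, inv_mul_cancel₀ (Nat.cast_ne_zero.2 Nat.card_pos.ne'), one_smul]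
  have hL : ∀ L ∈ minNormalOver A D, ∀ z, φ (hat L * z) = 0 := by
    intro L hL z
    obtain ⟨l, hl, hlD⟩ := SetLike.exists_of_lt hL.1.1
    have h1 := hφmul ⟨l, hL.1.2.1 hl⟩ (hat L * z)
    rw [← mul_assoc, of_mul_hat_of_mem hl] at h1
    -- `l` fixes `hat L`, so a nonzero value would force χ(l) = 1, although `l` is not in `D`.
    by_contra h0
    exact hlD ((hχ ⟨l, hL.1.2.1 hl⟩).1 (mul_right_cancel₀ h0 (by rw [← h1, one_mul])))
  have key : ∀ z, φ (eps A D * z) = φ z := by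
    by_cases h : A = D
    · subst h
      rw [eps_self]
      exact hD
    refine eps_induction h (fun y => ∀ z, φ (y * z) = φ z) (fun a b ha hb z => ?_)
      (fun z => by rw [one_mul]) fun L hL' z => ?_
    · rw [mul_assoc, ha, hb]
    · rw [sub_mul, map_sub, hD, hL L hL', sub_zero]
  intro h0
  have := key 1
  rw [h0, zero_mul, map_zero, hφ1] at this
  exact zero_ne_one this

theorem exists_injective_monoidHom_complex (C : Type*) [Group C] [Finite C] [IsCyclic C] :
    ∃ χ : C →* ℂ, Function.Injective χ := by
  have : NeZero (Nat.card C) := ⟨Nat.card_pos.ne'⟩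
  let e := zmodCyclicMulEquiv (G := C) ‹_›
  refine ⟨(ZMod.stdAddChar (N := Nat.card C)).toMonoidHom.comp e.symm.toMonoidHom, ?_⟩
  exact ZMod.injective_stdAddChar.comp e.symm.injective

/-! ### Cyclicity and maximality of A/D, restated with elements of G. -/

/-- The quotient map `A → N_G(D) / D`. -/
def toNormalizerQuotient {A D : Subgroup G} (hA : A ≤ Subgroup.normalizer (D : Set G)) :
    A →* Subgroup.normalizer (D : Set G) ⧸ D.subgroupOf (Subgroup.normalizer (D : Set G)) :=
  (QuotientGroup.mk' _).comp (Subgroup.inclusion hA)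

theorem toNormalizerQuotient_mem {A D : Subgroup G}
    (hA : A ≤ Subgroup.normalizer (D : Set G)) (a : A) :
    toNormalizerQuotient hA a ∈ quotInNormalizer A D :=
  ⟨Subgroup.inclusion hA a, a.2, rfl⟩

theorem toNormalizerQuotient_eq_one {A D : Subgroup G}
    (hA : A ≤ Subgroup.normalizer (D : Set G)) (a : A) :
    toNormalizerQuotient hA a = 1 ↔ (a : G) ∈ D :=
  QuotientGroup.eq_one_iff _

theorem mul_comm_of_mem_quotInNormalizer {A D : Subgroup G} (h : IsCyclic (quotInNormalizer A D))
    {x y} (hx : x ∈ quotInNormalizer A D) (hy : y ∈ quotInNormalizer A D) : x * y = y * x := by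
  let := IsCyclic.commGroup (α := quotInNormalizer A D)
  exact congrArg Subtype.val (mul_comm (⟨x, hx⟩ : quotInNormalizer A D) ⟨y, hy⟩)

theorem commutator_mem_of_mem_setD {N A D : Subgroup G} (h : D ∈ setD N A) :
    ∀ a ∈ A, ∀ b ∈ A, a * b * a⁻¹ * b⁻¹ ∈ D := by
  obtain ⟨-, -, -, hA, hcyc, -⟩ := h
  intro a ha b hb
  have := mul_comm_of_mem_quotInNormalizer hcyc (toNormalizerQuotient_mem hA ⟨a, ha⟩)
    (toNormalizerQuotient_mem hA ⟨b, hb⟩)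
  refine (toNormalizerQuotient_eq_one hA (⟨a, ha⟩ * ⟨b, hb⟩ * ⟨a, ha⟩⁻¹ * ⟨b, hb⟩⁻¹)).1 ?_
  rw [map_mul, map_mul, map_mul, this, map_inv, map_inv]
  group

/-- The class of `k` together with A/D generates an abelian subgroup, which maximality forces back
into A/D. -/
theorem mem_of_commutator_mem_of_mem_setD {N A D : Subgroup G} (h : D ∈ setD N A) {k : G}
    (hk : k ∈ Subgroup.normalizer (D : Set G)) (hcomm : ∀ a ∈ A, k * a * k⁻¹ * a⁻¹ ∈ D) :
    k ∈ A := by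
  obtain ⟨-, hDA, -, hA, hcyc, hmax⟩ := h
  let q := QuotientGroup.mk' (D.subgroupOf (Subgroup.normalizer (D : Set G)))
  have hkq : ∀ x ∈ quotInNormalizer A D, q ⟨k, hk⟩ * x = x * q ⟨k, hk⟩ := by
    rintro _ ⟨⟨a, ha'⟩, ha, rfl⟩
    have h1 : q (⟨k, hk⟩ * ⟨a, ha'⟩ * ⟨k, hk⟩⁻¹ * ⟨a, ha'⟩⁻¹) = 1 :=
      (QuotientGroup.eq_one_iff _).2 (hcomm a ha)
    rw [map_mul, map_mul, map_mul, map_inv, map_inv, mul_inv_eq_one, mul_inv_eq_iff_eq_mul] at h1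
    exact h1
  have hB : IsMulCommutative
      (Subgroup.closure (insert (q ⟨k, hk⟩) (quotInNormalizer A D : Set _))) := by
    refine Subgroup.isMulCommutative_closure ?_
    rintro x (rfl | hx) y (rfl | hy)
    · rfl
    · exact hkq y hy
    · exact (hkq x hx).symm
    · exact mul_comm_of_mem_quotInNormalizer hcyc hx hy
  have hle := hmax.2 hB fun x hx => Subgroup.subset_closure (Set.mem_insert_of_mem _ hx)
  obtain ⟨⟨a, ha'⟩, ha, haq⟩ := hle (Subgroup.subset_closure (Set.mem_insert _ _))
  have hD : a⁻¹ * k ∈ D := (QuotientGroup.eq (s := D.subgroupOf _)).1 haq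
  simpa using A.mul_mem ha (hDA hD)

theorem eps_ne_zero_of_mem_setD [Finite G] {N A D : Subgroup G} (h : D ∈ setD N A) :
    eps A D ≠ 0 := by
  obtain ⟨-, hDA, -, hA, hcyc, -⟩ := h
  obtain ⟨χ, hχ⟩ := exists_injective_monoidHom_complex (quotInNormalizer A D)
  refine eps_ne_zero hDA
    (χ.comp ((toNormalizerQuotient hA).codRestrict _ (toNormalizerQuotient_mem hA))) fun a => ?_
  rw [MonoidHom.comp_apply, map_eq_one_iff χ hχ, ← toNormalizerQuotient_eq_one hA, Subtype.ext_iff]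
  rfl

theorem isolates_eps_of_mem_setD [Finite G] {N A D : Subgroup G} (h : D ∈ setD N A) :
    Isolates A D (eps A D) :=
  isolates_eps h.2.1 (commutator_mem_of_mem_setD h)

/-! ### The central idempotents e(G, A, D) for a fixed A. -/

/-- The set of `G`-conjugates of `ε(H, K)`. -/
def conjEps [Finite G] (H K : Subgroup G) : Finset (MonoidAlgebra ℚ G) :=
  (Set.finite_range fun g : G => conjRingHom g (eps H K)).toFinset

theorem mem_conjEps [Finite G] {H K : Subgroup G} {y : MonoidAlgebra ℚ G} :
    y ∈ conjEps H K ↔ ∃ g, conjRingHom g (eps H K) = y := by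
  simp [conjEps]

theorem idem_eq_sum [Finite G] (H K : Subgroup G) : idem H K = ∑ y ∈ conjEps H K, y :=
  finsum_mem_eq_finite_toFinset_sum _ (Set.finite_range fun g : G => conjRingHom g (eps H K))

theorem commute_of_idem [Finite G] (H K : Subgroup G) (g : G) :
    Commute (of ℚ G g) (idem H K) := by
  have hmem : ∀ (g : G), ∀ y ∈ conjEps H K, conjRingHom g y ∈ conjEps H K := by
    intro g y hy
    obtain ⟨x, rfl⟩ := mem_conjEps.1 hy
    exact mem_conjEps.2 ⟨g * x, (conjRingHom_conjRingHom g x _).symm⟩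
  rw [← conjRingHom_eq_self_iff, idem_eq_sum, map_sum]
  exact Finset.sum_bij' (fun y _ => conjRingHom g y) (fun y _ => conjRingHom g⁻¹ y)
    (hmem g) (hmem g⁻¹) (fun y _ => conjRingHom_inv_conjRingHom g y)
    (fun y _ => conjRingHom_conjRingHom_inv g y) fun _ _ => rfl

/-- As `A` is normal, a conjugate of `eps A D` is determined by the corresponding conjugate of `D`;
distinct idempotents thus isolate distinct subgroups. -/
theorem mul_eq_zero_of_mem_conjEps [Finite G] {N N' A D D' : Subgroup G} [A.Normal]
    (h : D ∈ setD N A) (h' : D' ∈ setD N' A) {y y' : MonoidAlgebra ℚ G} (hy : y ∈ conjEps A D)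
    (hy' : y' ∈ conjEps A D') (hne : y ≠ y') : y * y' = 0 := by
  obtain ⟨g, rfl⟩ := mem_conjEps.1 hy
  obtain ⟨g', rfl⟩ := mem_conjEps.1 hy'
  have hle : ∀ {D : Subgroup G} (g : G), D ≤ A → conjSubgroup g D ≤ A := fun {D} g hD => by
    rw [← conjSubgroup_eq_self_of_normal g A]
    exact conjSubgroup_le_conjSubgroup.2 hD
  refine ((isolates_eps_of_mem_setD h).conj g).mul_eq_zero ((isolates_eps_of_mem_setD h').conj g')
    (hle g h.2.1) (hle g' h'.2.1) fun heq => hne ?_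
  rw [conjRingHom_eps, conjRingHom_eps, heq, conjSubgroup_eq_self_of_normal g A,
    conjSubgroup_eq_self_of_normal g' A]

theorem mul_idem_of_mem_conjEps [Finite G] {N A D : Subgroup G} [A.Normal]
    (h : D ∈ setD N A) {y : MonoidAlgebra ℚ G} (hy : y ∈ conjEps A D) : y * idem A D = y := by
  rw [idem_eq_sum, Finset.mul_sum, Finset.sum_eq_single_of_mem y hy fun z hz hzy =>
    mul_eq_zero_of_mem_conjEps h h hy hz hzy.symm]
  obtain ⟨g, rfl⟩ := mem_conjEps.1 hy
  exact ((isolates_eps_of_mem_setD h).conj g).mul_self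

theorem idem_mul_idem [Finite G] {N A D : Subgroup G} [A.Normal] (h : D ∈ setD N A) :
    idem A D * idem A D = idem A D := by
  conv_lhs => arg 1; rw [idem_eq_sum]
  rw [Finset.sum_mul, Finset.sum_congr rfl fun y hy => mul_idem_of_mem_conjEps h hy, idem_eq_sum]

theorem eps_mem_conjEps [Finite G] (H K : Subgroup G) : eps H K ∈ conjEps H K :=
  mem_conjEps.2 ⟨1, conjRingHom_one _⟩

theorem idem_ne_zero [Finite G] {N A D : Subgroup G} [A.Normal] (h : D ∈ setD N A) :
    idem A D ≠ 0 := by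
  intro h0
  have := mul_idem_of_mem_conjEps h (eps_mem_conjEps A D)
  rw [h0, mul_zero] at this
  exact eps_ne_zero_of_mem_setD h this.symm

/-- Idempotents of the same normal subgroup `A` attached to non-conjugate subgroups are
orthogonal. -/
theorem idem_mul_idem_of_not_conj [Finite G] {N N' A D D' : Subgroup G} [A.Normal]
    (h : D ∈ setD N A) (h' : D' ∈ setD N' A) (hne : ∀ g : G, conjSubgroup g D ≠ D') :
    idem A D * idem A D' = 0 := by
  rw [idem_eq_sum, idem_eq_sum, Finset.sum_mul_sum]
  refine Finset.sum_eq_zero fun y hy => Finset.sum_eq_zero fun y' hy' => ?_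
  obtain ⟨g, rfl⟩ := mem_conjEps.1 hy
  obtain ⟨g', rfl⟩ := mem_conjEps.1 hy'
  have hle : ∀ {D : Subgroup G} (g : G), D ≤ A → conjSubgroup g D ≤ A := fun {D} g hD => by
    rw [← conjSubgroup_eq_self_of_normal g A]
    exact conjSubgroup_le_conjSubgroup.2 hD
  refine ((isolates_eps_of_mem_setD h).conj g).mul_eq_zero ((isolates_eps_of_mem_setD h').conj g')
    (hle g h.2.1) (hle g' h'.2.1) fun heq => hne (g'⁻¹ * g) ?_
  rw [← conjSubgroup_conjSubgroup, heq, conjSubgroup_inv_conjSubgroup]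

/-! ### Recovering N as a kernel; orthogonality for different N. -/

/-- The kernel of the action of `G` on a nonzero ideal `f ℚ[G]` contained in `e(G, A, D) ℚ[G]`
is the core of `D`. -/
theorem leftFixer_eq_of_idem_mul_eq [Finite G] {N A D : Subgroup G} [A.Normal]
    (h : D ∈ setD N A) {f : MonoidAlgebra ℚ G} (hf : f ≠ 0) (hcent : ∀ g, Commute (of ℚ G g) f)
    (hef : idem A D * f = f) : leftFixer f = N := by
  obtain ⟨hND, hDA, hcore, -⟩ := id h
  have hN : N.Normal := hcore ▸ D.normalCore_normal
  have hK : ∀ k ∈ leftFixer f, ∀ g : G, g * k * g⁻¹ ∈ leftFixer f := by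
    intro k hk g
    rw [mem_leftFixer] at *
    rw [map_mul, mul_assoc, (hcent g⁻¹).eq, ← mul_assoc, map_mul, mul_assoc _ _ f, hk, mul_assoc,
      ← (hcent g⁻¹).eq, ← mul_assoc, ← map_mul, mul_inv_cancel, map_one, one_mul]
  -- Since `f` is central, `eps A D * f = 0` would make every conjugate kill `f`, hence `f = idem A
  -- D * f = 0`.
  have hεf : eps A D * f ≠ 0 := by
    intro h0
    apply hf
    rw [← hef, idem_eq_sum, Finset.sum_mul]
    refine Finset.sum_eq_zero fun y hy => ?_
    obtain ⟨g, rfl⟩ := mem_conjEps.1 hy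
    rw [← conjRingHom_eq_self_iff.2 (hcent g), ← map_mul, h0, map_zero]
  have hcomm : Commute (eps A D) f :=
    (isolates_eps_of_mem_setD h).commute f fun a _ => hcent a
  have hKA : ∀ k ∈ leftFixer f, k ∈ A → k ∈ D := by
    intro k hk hkA
    refine ((isolates_eps_of_mem_setD h).mem k hkA f ?_).resolve_right hεf
    rw [hcomm.eq, ← mul_assoc, mem_leftFixer.1 hk]
  have hKN : ∀ k ∈ leftFixer f, k ∈ A → k ∈ N := by
    intro k hk hkA
    rw [← hcore]
    intro g
    exact hKA _ (hK k hk g) (Subgroup.Normal.conj_mem ‹_› k hkA g)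
  apply le_antisymm
  · intro k hk
    -- The kernel and `A` are both normal, so the commutator lies in their intersection.
    have hcm : ∀ a ∈ A, k * a * k⁻¹ * a⁻¹ ∈ N := fun a ha => by
      refine hKN _ ?_ (A.mul_mem (Subgroup.Normal.conj_mem ‹_› a ha k) (A.inv_mem ha))
      have := (leftFixer f).mul_mem hk (hK _ ((leftFixer f).inv_mem hk) a)
      simpa only [mul_assoc] using this
    refine hKN k hk (mem_of_commutator_mem_of_mem_setD h ?_ fun a ha => hND (hcm a ha))
    -- By finiteness, k D k⁻¹ ≤ D suffices.
    refine Subgroup.mem_normalizer_fintype fun d hd => ?_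
    have := D.mul_mem (hND (hcm d (hDA hd))) hd
    simpa using this
  -- `N` is normal and below `D`, so it lies in every conjugate of `D` and fixes every summand of
  -- `idem A D`.
  · intro n hn
    rw [mem_leftFixer, ← hef, ← mul_assoc]
    congr 1
    rw [idem_eq_sum, Finset.mul_sum]
    refine Finset.sum_congr rfl fun y hy => ?_
    obtain ⟨g, rfl⟩ := mem_conjEps.1 hy
    refine ((isolates_eps_of_mem_setD h).conj g).le_leftFixer (mem_conjSubgroup.2 (hND ?_))
    simpa using hN.conj_mem n hn g⁻¹

theorem idem_mul_idem_of_ne [Finite G] {N N' A A' D D' : Subgroup G} [A.Normal] [A'.Normal]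
    (h : D ∈ setD N A) (h' : D' ∈ setD N' A') (hne : N ≠ N') :
    idem A D * idem A' D' = 0 := by
  by_contra h0
  have hc : ∀ g, Commute (of ℚ G g) (idem A D * idem A' D') := fun g =>
    (commute_of_idem A D g).mul_right (commute_of_idem A' D' g)
  have hcomm : Commute (idem A D) (idem A' D') := by
    rw [idem_eq_sum]
    refine Commute.sum_left _ _ _ fun y hy => ?_
    obtain ⟨g, rfl⟩ := mem_conjEps.1 hy
    exact ((isolates_eps_of_mem_setD h).conj g).commute _ fun a _ => commute_of_idem A' D' a
  refine hne ((leftFixer_eq_of_idem_mul_eq h h0 hc ?_).symm.trans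
    (leftFixer_eq_of_idem_mul_eq h' h0 hc ?_))
  · rw [← mul_assoc, idem_mul_idem h]
  · rw [hcomm.eq, ← mul_assoc, idem_mul_idem h']

/-! ### Dimension count. -/

/-- The left ideals generated by orthogonal idempotents are independent. -/
theorem sum_finrank_range_mulRight_le {R ι : Type*} [Ring R] [Algebra ℚ R] [FiniteDimensional ℚ R]
    (s : Finset ι) (e : ι → R) (hidem : ∀ i ∈ s, e i * e i = e i)
    (horth : ∀ i ∈ s, ∀ j ∈ s, i ≠ j → e i * e j = 0) :
    ∑ i ∈ s, Module.finrank ℚ (LinearMap.range (LinearMap.mulRight ℚ (e i))) ≤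
      Module.finrank ℚ R := by
  classical
  rw [← Finset.sum_coe_sort, ← Module.finrank_pi_fintype]
  let Ψ : (∀ i : s, LinearMap.range (LinearMap.mulRight ℚ (e i))) →ₗ[ℚ] R :=
    ∑ i : s, (Submodule.subtype _) ∘ₗ LinearMap.proj i
  have hΨ : ∀ v, Ψ v = ∑ i : s, (v i : R) := fun v => by simp [Ψ]
  refine LinearMap.finrank_le_finrank_of_injective (f := Ψ) ?_
  rw [← LinearMap.ker_eq_bot, LinearMap.ker_eq_bot']
  intro v hv
  funext j
  -- Right multiplication by `e j` extracts the `j`-th component.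
  have h1 : (∑ i : s, (v i : R)) * e j = v j := by
    rw [Finset.sum_mul, Finset.sum_eq_single j]
    · obtain ⟨x, hx⟩ := (v j).2
      rw [← hx, LinearMap.mulRight_apply, mul_assoc, hidem j j.2]
    · intro i _ hij
      obtain ⟨x, hx⟩ := (v i).2
      rw [← hx, LinearMap.mulRight_apply, mul_assoc, horth i i.2 j j.2 fun h => hij (Subtype.ext h),
        mul_zero]
    · exact fun h => absurd (Finset.mem_univ j) h
  rw [← hΨ, hv, zero_mul] at h1
  exact Subtype.ext h1.symm

theorem dim_pos_of_mem_setD [Finite G] {N A D : Subgroup G} [A.Normal] (h : D ∈ setD N A) :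
    0 < dim A D := by
  have : FiniteDimensional ℚ (MonoidAlgebra ℚ G) := finiteDimensional_monoidAlgebra G
  rw [dim, Module.finrank_pos_iff, Submodule.nontrivial_iff_ne_bot]
  intro hbot
  exact idem_ne_zero h ((Submodule.eq_bot_iff _).1 hbot _ ⟨1, one_mul _⟩)

theorem sum_dim_setS (A : Subgroup G) [Finite G] (T : Finset (Subgroup G)) :
    ∑ p ∈ setS A T, dim p.1 p.2 = ∑ D ∈ T, dim A D := by
  rw [setS, Finset.sum_product, Finset.sum_singleton]

end

end ShodaPair

theorem lemma3p2 {G : Type*} [Group G] [Finite G]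
    -- for every normal subgroup `N`, a fixed choice `A N` of `A_N` and `T N` of `𝒯_N`
    (A : Subgroup G → Subgroup G)
    (hA : ∀ (N : Subgroup G) [N.Normal], ShodaPair.IsMaxAbelianNormalOver N (A N))
    (T : Subgroup G → Finset (Subgroup G))
    (hT : ∀ N : Subgroup G, N.Normal → ShodaPair.IsConjReps (ShodaPair.setD N (A N)) (T N))
    (M : Finset (Subgroup G)) (hM : ∀ N ∈ M, N.Normal)
    (hsum : ∑ N ∈ M, ∑ p ∈ ShodaPair.setS (A N) (T N), ShodaPair.dim p.1 p.2 = Nat.card G) :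
    ∀ N : Subgroup G, N.Normal → N ∉ M → ShodaPair.setS (A N) (T N) = ∅ := by
  classical
  intro N₀ hN₀ hN₀M
  have : FiniteDimensional ℚ (MonoidAlgebra ℚ G) := ShodaPair.finiteDimensional_monoidAlgebra G
  have hnormal : ∀ N ∈ insert N₀ M, N.Normal := fun N hN =>
    (Finset.mem_insert.1 hN).elim (fun h => h ▸ hN₀) (hM N)
  have hAnormal : ∀ N ∈ insert N₀ M, (A N).Normal := fun N hN =>
    have := hnormal N hN
    (hA N).normal
  -- The bound is applied with `N₀` adjoined to `M`, leaving no room for its terms.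
  have hle : ∑ N ∈ insert N₀ M, ∑ p ∈ ShodaPair.setS (A N) (T N), ShodaPair.dim p.1 p.2 ≤
      Nat.card G := by
    simp only [ShodaPair.sum_dim_setS]
    rw [← ShodaPair.finrank_monoidAlgebra G, Finset.sum_sigma']
    refine ShodaPair.sum_finrank_range_mulRight_le ((insert N₀ M).sigma T)
      (fun i => ShodaPair.idem (A i.1) i.2) ?_ ?_
    · rintro ⟨N, D⟩ hi
      obtain ⟨hN, hD⟩ := Finset.mem_sigma.1 hi
      have := hAnormal N hN
      exact ShodaPair.idem_mul_idem ((hT N (hnormal N hN)).1 D hD)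
    · rintro ⟨N, D⟩ hi ⟨N', D'⟩ hj hij
      obtain ⟨hN, hD⟩ := Finset.mem_sigma.1 hi
      obtain ⟨hN', hD'⟩ := Finset.mem_sigma.1 hj
      have := hAnormal N hN
      have := hAnormal N' hN'
      have hDmem := (hT N (hnormal N hN)).1 D hD
      by_cases hNN : N = N'
      · subst hNN
        refine ShodaPair.idem_mul_idem_of_not_conj hDmem ((hT N (hnormal N hN)).1 D' hD')
          fun g hg => hij ?_
        -- `D` and `D'` would both represent the conjugacy class of `D`.
        have hDD : D = D' := ((hT N (hnormal N hN)).2 D hDmem).unique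
          ⟨hD, 1, ShodaPair.conjSubgroup_one D⟩ ⟨hD', g, hg⟩
        rw [hDD]
      · exact ShodaPair.idem_mul_idem_of_ne hDmem ((hT N' (hnormal N' hN')).1 D' hD') hNN
  rw [Finset.sum_insert hN₀M, hsum] at hle
  have hzero : ∑ p ∈ ShodaPair.setS (A N₀) (T N₀), ShodaPair.dim p.1 p.2 = 0 := by omega
  rw [Finset.eq_empty_iff_forall_notMem]
  rintro ⟨B, D⟩ hp
  have hdim := (Finset.sum_eq_zero_iff.1 hzero) _ hp
  obtain ⟨hB, hD⟩ := Finset.mem_product.1 hp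
  obtain rfl := Finset.mem_singleton.1 hB
  have := hAnormal N₀ (Finset.mem_insert_self _ _)
  exact (ShodaPair.dim_pos_of_mem_setD ((hT N₀ hN₀).1 D hD)).ne' hdim
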